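/- A *flow* on a metric space $(X,d)$ with discrete time is the family $f(n,x)=h^n(x)$, $n\in\mathbb Z$, of iterates of a homeomorphism $h:X\to X$. A point $p\in X$ (and the trajectory through it) is *unpredictable* if there exist $\epsilon_0>0$ and sequences $t_n\to+\infty$, $\tau_n\to+\infty$ such that $f(t_n,p)\to p$ as $n\to\infty$ and $d[f(t_n+\tau_n,p),f(\tau_n,p)]\ge\epsilon_0$ for every $n\in\mathbb N$. The plane $\mathbb R^2$ carries the Euclidean metric. (1) *Smale horseshoe.* Let $Q=[0,1]^2$, $\lambda,\mu>0$, $a_0,a_1\in[0,1-\lambda]$ and $b_0,b_1\in[0,1-1/\mu]$ with $|a_0-a_1|>\lambda$ and $|b_0-b_1|>1/\mu$, and let $H_i=[0,1]\times[b_i,b_i+1/\mu]$. Let $F$ be a Smale horseshoe map with these data, i.e. $F:\mathbb R^2\to\mathbb R^2$ is continuous and injective on $Q$, $$F(x,y)=(a_0+\lambda x,\ \mu(y-b_0))\ \text{ on } H_0,\qquad F(x,y)=(a_1+\lambda(1-x),\ 1-\mu(y-b_1))\ \text{ on } H_1,$$ and $F(Q\setminus(H_0\cup H_1))\cap Q=\emptyset$.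 Let $\Lambda$ be the set of all points through which there passes a two-sided orbit of $F$ contained in $Q$. Then $F$ restricts to a homeomorphism of $\Lambda$ onto itself, and the flow on $\Lambda$ generated by it has an unpredictable point whose trajectory $\{F^n(p):n\in\mathbb Z\}$ is contained in a compact subset of $\Lambda$. (2) *Hénon map.* Let $\beta\ne0$ and $\alpha\ge(5+2\sqrt5)(1+|\beta|)^2/4$ be real. Then the flow on $\mathbb R^2$ generated by the Hénon homeomorphism $(x,y)\mapsto(\alpha-\beta y-x^2,\ x)$ has an unpredictable point whose trajectory is contained in a compact subset of $\mathbb R^2$. -/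

import Mathlib

open Filter Topology

/-- The plane with its Euclidean metric. -/
abbrev Plane : Type := EuclideanSpace ℝ (Fin 2)

/-- A point `p` is unpredictable for the flow (or semi-flow) `φ` if there are a sensitivity
constant `ε₀ > 0` and times `t n → +∞`, `τ n → +∞` such that `φ (t n) p → p` while
`φ (t n + τ n) p` and `φ (τ n) p` stay at distance at least `ε₀`. -/
def IsUnpredictablePoint {T X : Type*} [AddMonoid T] [Preorder T] [TopologicalSpace T]
    [MetricSpace X] (φ : Flow T X) (p : X) : Prop :=
  ∃ ε₀ : ℝ, 0 < ε₀ ∧ ∃ t τ : ℕ → T, Tendsto t atTop atTop ∧ Tendsto τ atTop atTop ∧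
    Tendsto (fun n => φ (t n) p) atTop (𝓝 p) ∧
    ∀ n, ε₀ ≤ dist (φ (t n + τ n) p) (φ (τ n) p)

/-- The discrete flow `(n, x) ↦ hⁿ x`, `n ∈ ℤ`, generated by a homeomorphism `h`. -/
def iterationFlow {X : Type*} [TopologicalSpace X] (h : X ≃ₜ X) : Flow ℤ X where
  toFun n x := (h ^ n) x
  cont' := continuous_prod_of_discrete_left.mpr fun n => (h ^ n).continuous
  map_add' m n x := by rw [zpow_add]; rfl
  map_zero' x := by rw [zpow_zero]; rfl

/-- The Hénon map `(x, y) ↦ (α - β y - x², x)`, with inverse `(u, v) ↦ (v, (α - u - v²) / β)`. -/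
noncomputable def henonMap (α β : ℝ) (hβ : β ≠ 0) : Plane ≃ₜ Plane where
  toFun p := !₂[α - β * p 1 - p 0 ^ 2, p 0]
  invFun q := !₂[q 1, (α - q 0 - q 1 ^ 2) / β]
  left_inv p := by
    ext i
    fin_cases i
    · simp
    · simp only [Fin.mk_one, Matrix.cons_val_zero, Matrix.cons_val_one,
        Matrix.cons_val_fin_one]
      field_simp
      ring
  right_inv q := by
    ext i
    fin_cases i
    · simp only [Fin.zero_eta, Matrix.cons_val_zero, Matrix.cons_val_one,
        Matrix.cons_val_fin_one]
      field_simp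
      ring
    · simp
  continuous_toFun := by fun_prop
  continuous_invFun := by fun_prop

/-- The closed unit square. -/
def unitSquare : Set Plane := {p | p 0 ∈ Set.Icc 0 1 ∧ p 1 ∈ Set.Icc 0 1}

/-- The full-width horizontal strip `[0, 1] × [b, b + h]`. -/
def horizontalStrip (b h : ℝ) : Set Plane := {p | p 0 ∈ Set.Icc 0 1 ∧ p 1 ∈ Set.Icc b (b + h)}

/-- `F` is a Smale horseshoe map on the unit square `Q` with horizontal contraction rate `lam` and
vertical expansion rate `mu`: it is continuous and injective on `Q`; it maps two disjoint horizontal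
strips of height `1 / mu` in `Q` affinely onto two disjoint vertical strips of width `lam` in `Q`
of full height, preserving both axis directions on strip number `0` and reversing both on strip
number `1`; and it maps every other point of `Q` outside `Q`. The strips
are `[0, 1] × [bᵢ, bᵢ + 1 / mu]` and `[aᵢ, aᵢ + lam] × [0, 1]`. -/
structure IsSmaleHorseshoe (lam mu a₀ a₁ b₀ b₁ : ℝ) (F : Plane → Plane) : Prop where
  lam_pos : 0 < lam
  mu_pos : 0 < mu
  a₀_mem : a₀ ∈ Set.Icc 0 (1 - lam)
  a₁_mem : a₁ ∈ Set.Icc 0 (1 - lam)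
  b₀_mem : b₀ ∈ Set.Icc 0 (1 - 1 / mu)
  b₁_mem : b₁ ∈ Set.Icc 0 (1 - 1 / mu)
  vertical_disjoint : lam < |a₀ - a₁|
  horizontal_disjoint : 1 / mu < |b₀ - b₁|
  continuousOn : ContinuousOn F unitSquare
  injOn : Set.InjOn F unitSquare
  strip_zero : ∀ p ∈ horizontalStrip b₀ (1 / mu),
    F p = !₂[a₀ + lam * p 0, mu * (p 1 - b₀)]
  strip_one : ∀ p ∈ horizontalStrip b₁ (1 / mu),
    F p = !₂[a₁ + lam * (1 - p 0), 1 - mu * (p 1 - b₁)]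
  maps_out : ∀ p ∈ unitSquare, p ∉ horizontalStrip b₀ (1 / mu) →
    p ∉ horizontalStrip b₁ (1 / mu) → F p ∉ unitSquare

/-- The maximal invariant set of `F` in the unit square: the points through which there passes
a two-sided orbit of `F` that stays in the square. -/
def horseshoeInvariantSet (F : Plane → Plane) : Set Plane :=
  {q | ∃ z : ℤ → Plane, z 0 = q ∧ (∀ n, z n ∈ unitSquare) ∧ ∀ n, F (z n) = z (n + 1)}

/-! Both maps contain a continuous equivariant image of the full two-sided shift on two symbols, and
sequences that differ at index 0 have images a fixed distance apart. By
`exists_unpredictable_of_coding`, one recurrent sequence that never settles then suffices; neither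
injectivity of the coding nor a description of its image is needed.

The coding solves the orbit equation as a boundary-free recursion: given the symbols, the state at
time `n` is a function of the states at times `n - 1` and `n + 1` (`exists_coding_of_recursion`).
For the horseshoe, the horizontal coordinate comes from the past and the vertical one from the
future through inverse branches. For Hénon, `x n` is a square root of `α - x (n + 1) - β * x (n -
1)`, its sign given by the symbol. At the threshold value of `α` the available Lipschitz bound is
only 1, so the estimate used is `d + k * d ^ 2 ≤ e` instead of a strict contraction ratio. -/

/-! ### A recurrent two-sided binary sequence -/

/-- The two-sided sequence recording the parity of the 2-adic valuation. -/
def valuationParity (i : ℤ) : Bool := decide (Even (padicValInt 2 i))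

lemma padicValInt_two_pow (m : ℕ) : padicValInt 2 ((2 : ℤ) ^ m) = m := by
  simp [padicValInt, Int.natAbs_pow]

/-- A nonzero `i` with `|i| < 2 ^ m` has valuation below `m`, and adding `2 ^ m` does not affect
divisibility by `2 ^ k` for `k ≤ m`. -/
lemma padicValInt_add_two_pow {i : ℤ} (hi : i ≠ 0) {m : ℕ} (him : |i| < 2 ^ m) :
    padicValInt 2 (i + 2 ^ m) = padicValInt 2 i := by
  have hlt : padicValInt 2 i < m := by
    have h1 : (2 : ℤ) ^ padicValInt 2 i ∣ i := by
      simpa using padicValInt_dvd (p := 2) i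
    have h2 := Int.le_of_dvd (abs_pos.mpr hi) ((dvd_abs _ _).mpr h1)
    exact (pow_lt_pow_iff_right₀ (by norm_num : (1 : ℤ) < 2)).mp (h2.trans_lt him)
  have hne : i + 2 ^ m ≠ 0 := by
    intro h
    have : i = -2 ^ m := by linarith
    rw [this, abs_neg, abs_of_nonneg (by positivity)] at him
    exact lt_irrefl _ him
  have key : ∀ k : ℕ, k ≤ m → ((2 : ℤ) ^ k ∣ i + 2 ^ m ↔ (2 : ℤ) ^ k ∣ i) := fun k hk =>
    (Int.dvd_add_left (pow_dvd_pow 2 hk))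
  apply le_antisymm
  · by_contra! h
    have h1 : (2 : ℤ) ^ (padicValInt 2 i + 1) ∣ i + 2 ^ m :=
      (pow_dvd_pow 2 h).trans (by simpa using padicValInt_dvd (p := 2) (i + 2 ^ m))
    rw [key _ hlt] at h1
    have := (padicValInt_dvd_iff (p := 2) (padicValInt 2 i + 1) i).mp (by simpa using h1)
    omega
  · have h1 : (2 : ℤ) ^ padicValInt 2 i ∣ i + 2 ^ m :=
      (key _ hlt.le).mpr (by simpa using padicValInt_dvd (p := 2) i)
    have := (padicValInt_dvd_iff (p := 2) (padicValInt 2 i) (i + 2 ^ m)).mp (by simpa using h1)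
    tauto

lemma valuationParity_add_four_pow {i : ℤ} {m : ℕ} (him : |i| < 2 ^ (2 * m)) :
    valuationParity (i + 2 ^ (2 * m)) = valuationParity i := by
  unfold valuationParity
  rcases eq_or_ne i 0 with rfl | hi
  -- The default `padicValInt 2 0 = 0` is even, as is the exponent `2 * m`; this is why powers of 4
  -- are used.
  · rw [zero_add, padicValInt_two_pow]
    simp
  · rw [padicValInt_add_two_pow hi him]

lemma valuationParity_four_pow_ne (m : ℕ) :
    valuationParity ((2 : ℤ) ^ (2 * m) + 2 ^ (2 * m)) ≠ valuationParity (2 ^ (2 * m)) := by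
  unfold valuationParity
  rw [← two_mul, ← pow_succ', padicValInt_two_pow, padicValInt_two_pow]
  simp [parity_simps]

/-! ### Unpredictable points from symbolic codings -/

lemma iterationFlow_coding {X : Type*} [TopologicalSpace X] (h : X ≃ₜ X)
    (φ : (ℤ → Bool) → X) (hφ : ∀ s, φ (fun n => s (n + 1)) = h (φ s)) (m : ℤ) (s : ℤ → Bool) :
    iterationFlow h m (φ s) = φ (fun n => s (n + m)) := by
  change (h ^ m) (φ s) = _
  induction m using Int.induction_on with
  | zero => simp
  | succ k ih =>
    rw [add_comm, zpow_one_add]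
    change h ((h ^ (k : ℤ)) (φ s)) = _
    rw [ih, ← hφ]
    congr 1; funext n; congr 1; ring
  | pred k ih =>
    apply h.injective
    have : h ((h ^ (-(k : ℤ) - 1)) (φ s)) = (h ^ (-(k : ℤ))) (φ s) := by
      conv_rhs => rw [show -(k : ℤ) = 1 + (-(k : ℤ) - 1) by ring, zpow_one_add]
      rfl
    rw [this, ih, ← hφ]
    congr 1; funext n; congr 1; ring

/-- Take `t n = τ n = 4 ^ n`. Shifting `valuationParity` by `4 ^ n` preserves the window `|i| < 4 ^
n`, which gives recurrence, but changes the symbol at `4 ^ n`, since doubling raises the valuation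
by one. -/
theorem exists_unpredictable_of_coding {X : Type*} [MetricSpace X] (h : X ≃ₜ X)
    (φ : (ℤ → Bool) → X) (hcont : Continuous φ) (hφ : ∀ s, φ (fun n => s (n + 1)) = h (φ s))
    {ε : ℝ} (hε : 0 < ε) (hsep : ∀ s s' : ℤ → Bool, s 0 ≠ s' 0 → ε ≤ dist (φ s) (φ s')) :
    ∃ p, IsUnpredictablePoint (iterationFlow h) p ∧
      ∃ K : Set X, IsCompact K ∧ (iterationFlow h).orbit p ⊆ K := by
  have htop : Tendsto (fun n : ℕ => (2 : ℤ) ^ (2 * n)) atTop atTop :=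
    (tendsto_pow_atTop_atTop_of_one_lt (by norm_num : (1 : ℤ) < 2)).comp
      (tendsto_id.const_mul_atTop' (by norm_num))
  refine ⟨φ valuationParity, ⟨ε, hε, fun n => 2 ^ (2 * n), fun n => 2 ^ (2 * n), htop, htop,
    ?_, fun n => ?_⟩, Set.range φ, isCompact_range hcont, ?_⟩
  · simp only [iterationFlow_coding h φ hφ]
    refine (hcont.tendsto _).comp (tendsto_pi_nhds.mpr fun i => ?_)
    refine tendsto_const_nhds.congr' ?_
    filter_upwards [htop.eventually_gt_atTop |i|] with n hn
    exact (valuationParity_add_four_pow hn).symm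
  · rw [iterationFlow_coding h φ hφ, iterationFlow_coding h φ hφ]
    apply hsep
    simpa using valuationParity_four_pow_ne n
  · rintro _ ⟨m, rfl⟩
    exact ⟨_, (iterationFlow_coding h φ hφ m _).symm⟩

/-! ### Codings from nearest-neighbour recursions -/

/-- If `m > 0`, each term is at most `m / 2` or loses at least `k * (m / 2) ^ 2` from `m`, so the
supremum stays uniformly below `m`. -/
lemma eq_zero_of_forall_add_mul_sq_le {ι : Type*} [Nonempty ι] {k m : ℝ} (hk : 0 < k)
    (hm : 0 ≤ m) {d : ι → ℝ} (hdm : ∀ i, d i + k * d i ^ 2 ≤ m)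
    (hsup : m ≤ ⨆ i, d i) : m = 0 := by
  by_contra hne
  have hm : 0 < m := lt_of_le_of_ne hm (Ne.symm hne)
  have hle : ⨆ i, d i ≤ max (m / 2) (m - k * (m / 2) ^ 2) := by
    refine ciSup_le fun i => ?_
    rcases le_total (d i) (m / 2) with h | h
    · exact h.trans (le_max_left _ _)
    · refine le_trans ?_ (le_max_right _ _)
      have : (m / 2) ^ 2 ≤ d i ^ 2 := by gcongr
      nlinarith [hdm i, mul_le_mul_of_nonneg_left this hk.le]
  have : max (m / 2) (m - k * (m / 2) ^ 2) < m := max_lt (by linarith) (by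
    have : 0 < k * (m / 2) ^ 2 := by positivity
    linarith)
  linarith

section Coding

variable {Y : Type*} [MetricSpace Y] [CompactSpace Y]

lemma bddAbove_range_dist {ι : Type*} (x y : ι → Y) :
    BddAbove (Set.range fun i => dist (x i) (y i)) :=
  ⟨Metric.diam (Set.univ : Set Y), by
    rintro _ ⟨i, rfl⟩
    exact Metric.dist_le_diam_of_mem isCompact_univ.isBounded trivial trivial⟩

lemma eq_of_isFixedPt_of_weak_contraction {ι : Type*} [Nonempty ι] {T : (ι → Y) → ι → Y}
    {k : ℝ} (hk : 0 < k) (hT : ∀ x x' e, (∀ i, dist (x i) (x' i) ≤ e) →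
      ∀ i, dist (T x i) (T x' i) + k * dist (T x i) (T x' i) ^ 2 ≤ e)
    {x x' : ι → Y} (hx : T x = x) (hx' : T x' = x') : x = x' := by
  have hb := bddAbove_range_dist x x'
  have h0 : (⨆ i, dist (x i) (x' i)) = 0 := by
    refine eq_zero_of_forall_add_mul_sq_le hk (Real.iSup_nonneg fun _ => dist_nonneg)
      (fun i => ?_) le_rfl
    simpa [hx, hx'] using hT x x' _ (fun i => le_ciSup hb i) i
  funext i
  exact dist_le_zero.mp ((le_ciSup hb i).trans h0.le)

lemma exists_isFixedPt_of_weak_contraction {ι : Type*} [Nonempty ι] [Nonempty Y]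
    {T : (ι → Y) → ι → Y} (hc : Continuous T)
    {k : ℝ} (hk : 0 < k) (hT : ∀ x x' e, (∀ i, dist (x i) (x' i) ≤ e) →
      ∀ i, dist (T x i) (T x' i) + k * dist (T x i) (T x' i) ^ 2 ≤ e) :
    ∃ x, T x = x := by
  -- The displacement in sup distance is only lower semicontinuous for the product topology, which
  -- is enough for a minimum on a compact space. At a minimiser `x`, the displacement of `T x`
  -- cannot be smaller, so weak contraction forces it to vanish.
  have hlsc : LowerSemicontinuous fun x : ι → Y => ⨆ i, dist (T x i) (x i) :=
    lowerSemicontinuous_ciSup (fun x => bddAbove_range_dist _ _) fun i =>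
      (Continuous.lowerSemicontinuous (by fun_prop))
  obtain ⟨x, -, hx⟩ := (hlsc.lowerSemicontinuousOn Set.univ).exists_isMinOn
    Set.univ_nonempty isCompact_univ
  have hb := bddAbove_range_dist (T x) x
  have h0 : (⨆ i, dist (T x i) (x i)) = 0 :=
    eq_zero_of_forall_add_mul_sq_le hk (Real.iSup_nonneg fun _ => dist_nonneg)
      (hT (T x) x _ (fun i => le_ciSup hb i)) (hx (Set.mem_univ (T x)))
  refine ⟨x, funext fun i => ?_⟩
  exact dist_le_zero.mp ((le_ciSup hb i).trans h0.le)

/-- A weakly contracting nearest-neighbour recursion on a compact space, driven by a two-sided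
binary sequence, has a unique solution, which depends continuously and equivariantly on the
sequence. -/
theorem exists_coding_of_recursion [Nonempty Y] (G : Bool → Bool → Y → Y → Y)
    (hG : ∀ a b, Continuous fun p : Y × Y => G a b p.1 p.2) {k : ℝ} (hk : 0 < k)
    (hcontr : ∀ a b u u' v v' e, dist u u' ≤ e → dist v v' ≤ e →
      dist (G a b u v) (G a b u' v') + k * dist (G a b u v) (G a b u' v') ^ 2 ≤ e) :
    ∃ Φ : (ℤ → Bool) → ℤ → Y, Continuous Φ ∧
      (∀ s n, Φ s n = G (s (n - 1)) (s n) (Φ s (n - 1)) (Φ s (n + 1))) ∧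
      ∀ s, Φ (fun n => s (n + 1)) = fun n => Φ s (n + 1) := by
  let T : (ℤ → Bool) → (ℤ → Y) → ℤ → Y := fun s x n =>
    G (s (n - 1)) (s n) (x (n - 1)) (x (n + 1))
  have hGc : Continuous fun q : (Bool × Bool) × (Y × Y) => G q.1.1 q.1.2 q.2.1 q.2.2 :=
    continuous_prod_of_discrete_left.mpr fun a => hG a.1 a.2
  have hTc : Continuous fun q : (ℤ → Bool) × (ℤ → Y) => T q.1 q.2 :=
    continuous_pi fun n => hGc.comp (f := fun q : (ℤ → Bool) × (ℤ → Y) =>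
      ((q.1 (n - 1), q.1 n), (q.2 (n - 1), q.2 (n + 1)))) (by fun_prop)
  have hT : ∀ s x x' e, (∀ i, dist (x i) (x' i) ≤ e) →
      ∀ i, dist (T s x i) (T s x' i) + k * dist (T s x i) (T s x' i) ^ 2 ≤ e :=
    fun s x x' e h i => hcontr _ _ _ _ _ _ _ (h _) (h _)
  have hex : ∀ s, ∃ x, T s x = x := fun s =>
    exists_isFixedPt_of_weak_contraction (hTc.comp (Continuous.prodMk_right s)) hk (hT s)
  choose Φ hΦ using hex
  have huniq : ∀ s x, T s x = x → x = Φ s := fun s x hx =>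
    eq_of_isFixedPt_of_weak_contraction hk (hT s) hx (hΦ s)
  refine ⟨Φ, ?_, fun s n => (congrFun (hΦ s) n).symm, fun s => ?_⟩
  -- Closed graph argument: by uniqueness the graph of `Φ` is the closed set of solutions, and
  -- projection along a compact factor is closed.
  · refine continuous_iff_isClosed.mpr fun C hC => ?_
    have himage : Φ ⁻¹' C = Prod.fst '' {q : (ℤ → Bool) × (ℤ → Y) | T q.1 q.2 = q.2 ∧ q.2 ∈ C} := by
      ext s
      refine ⟨fun hs => ⟨(s, Φ s), ⟨hΦ s, hs⟩, rfl⟩, ?_⟩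
      rintro ⟨⟨s, x⟩, ⟨hx, hxC⟩, rfl⟩
      rw [Set.mem_preimage, ← huniq s x hx]
      exact hxC
    rw [himage]
    exact isClosedMap_fst_of_compactSpace _
      ((isClosed_eq hTc continuous_snd).inter (hC.preimage continuous_snd))
  · refine (huniq _ _ (funext fun n => ?_)).symm
    have := congrFun (hΦ s) (n + 1)
    simp only [T] at this ⊢
    rw [← this, sub_add_cancel, add_sub_cancel_right]

end Coding

/-! ### The plane -/

lemma abs_apply_sub_le_dist (p q : Plane) (i : Fin 2) : |p i - q i| ≤ dist p q := by
  rw [dist_eq_norm]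
  simpa using PiLp.norm_apply_le (p - q) i

lemma isCompact_unitSquare : IsCompact unitSquare := by
  have himage : unitSquare = (fun q : ℝ × ℝ => (!₂[q.1, q.2] : Plane)) ''
      (Set.Icc 0 1 ×ˢ Set.Icc 0 1) := by
    ext p
    constructor
    · intro hp
      refine ⟨(p 0, p 1), hp, ?_⟩
      ext i
      fin_cases i <;> simp
    · rintro ⟨q, hq, rfl⟩
      exact ⟨hq.1, hq.2⟩
  rw [himage]
  exact (isCompact_Icc.prod isCompact_Icc).image (by fun_prop)

/-! ### The Smale horseshoe -/

lemma horseshoeInvariantSet_subset (F : Plane → Plane) :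
    horseshoeInvariantSet F ⊆ unitSquare := by
  rintro _ ⟨z, rfl, hz, -⟩
  exact hz 0

/-- The orbits in the square form a closed subset of a compact product, and evaluation at time 0 is
continuous. -/
lemma isCompact_horseshoeInvariantSet {F : Plane → Plane} (hF : ContinuousOn F unitSquare) :
    IsCompact (horseshoeInvariantSet F) := by
  have : CompactSpace unitSquare := isCompact_iff_compactSpace.mp isCompact_unitSquare
  have hF' : Continuous fun q : unitSquare => F q := continuousOn_iff_continuous_domRestrict.mp hF
  have himage : horseshoeInvariantSet F = (fun w : ℤ → unitSquare => (w 0 : Plane)) ''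
      {w | ∀ n, F (w n) = w (n + 1)} := by
    ext q
    constructor
    · rintro ⟨z, hz0, hz, hFz⟩
      exact ⟨fun n => ⟨z n, hz n⟩, hFz, hz0⟩
    · rintro ⟨w, hw, rfl⟩
      exact ⟨fun n => w n, rfl, fun n => (w n).2, hw⟩
  rw [himage]
  refine IsCompact.image (IsClosed.isCompact ?_) (by fun_prop)
  rw [Set.ofPred_forall]
  exact isClosed_iInter fun n => isClosed_eq (hF'.comp (continuous_apply n)) (by fun_prop)

lemma bijOn_horseshoeInvariantSet {F : Plane → Plane} (hF : Set.InjOn F unitSquare) :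
    Set.BijOn F (horseshoeInvariantSet F) (horseshoeInvariantSet F) := by
  have hshift : ∀ z : ℤ → Plane, (∀ n, z n ∈ unitSquare) → (∀ n, F (z n) = z (n + 1)) →
      ∀ m, z m ∈ horseshoeInvariantSet F := fun z hz hFz m =>
    ⟨fun n => z (n + m), by simp, fun n => hz _, fun n => by rw [hFz]; congr 1; ring⟩
  refine ⟨?_, hF.mono (horseshoeInvariantSet_subset F), ?_⟩
  · rintro _ ⟨z, rfl, hz, hFz⟩
    rw [hFz]
    exact hshift z hz hFz _
  · rintro _ ⟨z, rfl, hz, hFz⟩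
    exact ⟨z (-1), hshift z hz hFz _, by simpa using hFz (-1)⟩

lemma exists_homeomorph_horseshoeInvariantSet {F : Plane → Plane}
    (hc : ContinuousOn F unitSquare) (hi : Set.InjOn F unitSquare) :
    ∃ h : horseshoeInvariantSet F ≃ₜ horseshoeInvariantSet F, ∀ q, (h q : Plane) = F q := by
  have : CompactSpace (horseshoeInvariantSet F) :=
    isCompact_iff_compactSpace.mp (isCompact_horseshoeInvariantSet hc)
  have hb := bijOn_horseshoeInvariantSet hi
  let e : horseshoeInvariantSet F ≃ horseshoeInvariantSet F := hb.equiv F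
  have he : Continuous e :=
    (hc.mono (horseshoeInvariantSet_subset F)).mapsToRestrict hb.mapsTo
  exact ⟨he.homeoOfEquivCompactToT2, fun q => rfl⟩

lemma affine_mem_Icc {a r x : ℝ} (hr : 0 ≤ r) (ha : a ∈ Set.Icc 0 (1 - r))
    (hx : x ∈ Set.Icc (0 : ℝ) 1) : a + r * x ∈ Set.Icc (0 : ℝ) 1 := by
  obtain ⟨hx0, hx1⟩ := hx
  obtain ⟨ha0, ha1⟩ := ha
  constructor
  · positivity
  · nlinarith

/-- The affine contraction of the unit interval onto `[a i, a i + r]`, preserving orientation for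
`i = false` and reversing it for `i = true`. -/
def branch (a : Bool → ℝ) (r : ℝ) (hr : 0 ≤ r) (ha : ∀ i, a i ∈ Set.Icc 0 (1 - r)) (i : Bool)
    (x : Set.Icc (0 : ℝ) 1) : Set.Icc (0 : ℝ) 1 :=
  ⟨a i + r * (bif i then 1 - (x : ℝ) else x), affine_mem_Icc hr (ha i) (by
    obtain ⟨x, hx⟩ := x
    cases i
    · exact hx
    · exact Set.Icc.mem_iff_one_sub_mem.mp hx)⟩

section Branch

variable {a : Bool → ℝ} {r : ℝ} {hr : 0 ≤ r} {ha : ∀ i, a i ∈ Set.Icc 0 (1 - r)}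

lemma continuous_branch (i : Bool) : Continuous (branch a r hr ha i) := by
  unfold branch
  cases i <;> exact Continuous.subtype_mk (by simp only [cond_true, cond_false]; fun_prop) _

lemma dist_branch (i : Bool) (x y : Set.Icc (0 : ℝ) 1) :
    dist (branch a r hr ha i x) (branch a r hr ha i y) = r * dist x y := by
  have hmul : r * |(x : ℝ) - y| = |r * ((x : ℝ) - y)| := by rw [abs_mul, abs_of_nonneg hr]
  rw [Subtype.dist_eq, Subtype.dist_eq, Real.dist_eq, Real.dist_eq, hmul]
  cases i
  · simp only [branch, cond_false]
    congr 1; ring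
  · simp only [branch, cond_true]
    rw [← abs_neg]
    congr 1; ring

end Branch

/-- Here `d ^ 2 ≤ d` and `2 * d ≤ e`, so a ratio of at most one half on the unit interval is a weak
contraction with `k = 1`. -/
lemma add_sq_le_of_le_half {d e r : ℝ} (hd0 : 0 ≤ d) (hd1 : d ≤ 1) (hr : r ≤ 1 / 2)
    (he : 0 ≤ e) (hd : d ≤ r * e) : d + 1 * d ^ 2 ≤ e := by
  nlinarith

lemma lt_half_of_lt_abs_sub {a₀ a₁ r : ℝ} (h₀ : a₀ ∈ Set.Icc 0 (1 - r))
    (h₁ : a₁ ∈ Set.Icc 0 (1 - r)) (h : r < |a₀ - a₁|) : r < 1 / 2 := by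
  obtain ⟨h1, h2⟩ := h₀
  obtain ⟨h3, h4⟩ := h₁
  have : |a₀ - a₁| ≤ 1 - r := abs_sub_le_iff.mpr ⟨by linarith, by linarith⟩
  linarith

theorem exists_coding_of_branches {a b : Bool → ℝ} {r s : ℝ} (hr : 0 ≤ r) (hs : 0 ≤ s)
    (ha : ∀ i, a i ∈ Set.Icc 0 (1 - r)) (hb : ∀ i, b i ∈ Set.Icc 0 (1 - s))
    (hr2 : r ≤ 1 / 2) (hs2 : s ≤ 1 / 2) :
    ∃ Φ : (ℤ → Bool) → ℤ → Set.Icc (0 : ℝ) 1 × Set.Icc (0 : ℝ) 1, Continuous Φ ∧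
      (∀ w n, Φ w n = (branch a r hr ha (w (n - 1)) (Φ w (n - 1)).1,
        branch b s hs hb (w n) (Φ w (n + 1)).2)) ∧
      ∀ w, Φ (fun n => w (n + 1)) = fun n => Φ w (n + 1) := by
  refine exists_coding_of_recursion
    (fun i j u v => (branch a r hr ha i u.1, branch b s hs hb j v.2)) (fun i j => ?_)
    one_pos fun i j u u' v v' e hu hv => ?_
  · exact ((continuous_branch i).comp (continuous_fst.comp continuous_fst)).prodMk
      ((continuous_branch j).comp (continuous_snd.comp continuous_snd))
  · have hone : ∀ x y : Set.Icc (0 : ℝ) 1, dist x y ≤ 1 := fun x y => by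
      rw [Subtype.dist_eq]
      exact Real.dist_le_of_mem_Icc_01 x.2 y.2
    have he : 0 ≤ e := dist_nonneg.trans hu
    rw [Prod.dist_eq] at hu hv ⊢
    rcases max_choice (dist (branch a r hr ha i u.1) (branch a r hr ha i u'.1))
      (dist (branch b s hs hb j v.2) (branch b s hs hb j v'.2)) with h | h <;> simp only [h]
    · refine add_sq_le_of_le_half dist_nonneg (hone _ _) hr2 he ?_
      rw [dist_branch]
      exact mul_le_mul_of_nonneg_left ((le_max_left _ _).trans hu) hr
    · refine add_sq_le_of_le_half dist_nonneg (hone _ _) hs2 he ?_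
      rw [dist_branch]
      exact mul_le_mul_of_nonneg_left ((le_max_right _ _).trans hv) hs

lemma sub_le_abs_affine_sub {b₀ b₁ s u v : ℝ} (hs : 0 ≤ s) (hu : u ∈ Set.Icc (0 : ℝ) 1)
    (hv : v ∈ Set.Icc (0 : ℝ) 1) : |b₀ - b₁| - s ≤ |b₀ + s * u - (b₁ + s * v)| := by
  have h1 : |s * u - s * v| ≤ s := by
    rw [← mul_sub, abs_mul, abs_of_nonneg hs]
    exact mul_le_of_le_one_right hs
      (abs_sub_le_iff.mpr ⟨by linarith [hu.2, hv.1], by linarith [hv.2, hu.1]⟩)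
  have h2 := abs_sub_abs_le_abs_sub (b₀ - b₁) (-(s * u - s * v))
  rw [abs_neg] at h2
  rw [show b₀ + s * u - (b₁ + s * v) = b₀ - b₁ - -(s * u - s * v) by ring]
  linarith

theorem IsSmaleHorseshoe.exists_unpredictable {lam mu a₀ a₁ b₀ b₁ : ℝ} {F : Plane → Plane}
    (hF : IsSmaleHorseshoe lam mu a₀ a₁ b₀ b₁ F)
    (h : horseshoeInvariantSet F ≃ₜ horseshoeInvariantSet F) (hh : ∀ q, (h q : Plane) = F q) :
    ∃ p, IsUnpredictablePoint (iterationFlow h) p ∧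
      ∃ K : Set (horseshoeInvariantSet F), IsCompact K ∧ (iterationFlow h).orbit p ⊆ K := by
  have hmu := hF.mu_pos
  have hs : 0 ≤ 1 / mu := by positivity
  have ha : ∀ i, (bif i then a₁ else a₀) ∈ Set.Icc 0 (1 - lam) := by
    rintro (_ | _); exacts [hF.a₀_mem, hF.a₁_mem]
  have hb : ∀ i, (bif i then b₁ else b₀) ∈ Set.Icc 0 (1 - 1 / mu) := by
    rintro (_ | _); exacts [hF.b₀_mem, hF.b₁_mem]
  obtain ⟨Φ, hΦc, hΦ, hΦshift⟩ := exists_coding_of_branches hF.lam_pos.le hs ha hb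
    (lt_half_of_lt_abs_sub hF.a₀_mem hF.a₁_mem hF.vertical_disjoint).le
    (lt_half_of_lt_abs_sub hF.b₀_mem hF.b₁_mem hF.horizontal_disjoint).le
  let z : (ℤ → Bool) → ℤ → Plane := fun w n => !₂[(Φ w n).1, (Φ w n).2]
  have hz0 : ∀ w n, z w n 0 = (Φ w n).1 := fun w n => rfl
  have hz1 : ∀ w n, z w n 1 = (Φ w n).2 := fun w n => rfl
  have hzQ : ∀ w n, z w n ∈ unitSquare := fun w n => ⟨(Φ w n).1.2, (Φ w n).2.2⟩
  have hy : ∀ w n, z w n 1 = (bif w n then b₁ else b₀) +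
      1 / mu * (bif w n then 1 - z w (n + 1) 1 else z w (n + 1) 1) := fun w n => by
    rw [hz1, hz1, hΦ w n]; rfl
  have hx : ∀ w n, z w (n + 1) 0 = (bif w n then a₁ else a₀) +
      lam * (bif w n then 1 - z w n 0 else z w n 0) := fun w n => by
    rw [hz0, hz0, hΦ w (n + 1), add_sub_cancel_right]; rfl
  -- The vertical recursion puts `z w n` in the strip labelled `w n`, where the affine formula for
  -- `F` inverts that recursion.
  have hstep : ∀ w n, F (z w n) = z w (n + 1) := fun w n => by
    have h1 := hy w n
    have h2 := hx w n
    obtain ⟨hQ0, hQ1⟩ := (hzQ w (n + 1)).2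
    cases hw : w n
    · rw [hw] at h1 h2
      simp only [cond_false] at h1 h2
      rw [hF.strip_zero _ ⟨(hzQ w n).1, by
        rw [h1]; constructor
        · have : 0 ≤ 1 / mu * z w (n + 1) 1 := by positivity
          linarith
        · have := mul_le_of_le_one_right hs hQ1
          linarith⟩, h1, ← h2]
      ext i
      fin_cases i
      · simp
      · simp; field_simp
    · rw [hw] at h1 h2
      simp only [cond_true] at h1 h2
      rw [hF.strip_one _ ⟨(hzQ w n).1, by
        rw [h1]; constructor
        · have : 0 ≤ 1 / mu * (1 - z w (n + 1) 1) := mul_nonneg hs (by linarith)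
          linarith
        · have := mul_le_of_le_one_right hs (by linarith : 1 - z w (n + 1) 1 ≤ 1)
          linarith⟩, h1, ← h2]
      ext i
      fin_cases i
      · simp
      · simp; field_simp; ring
  let φ : (ℤ → Bool) → horseshoeInvariantSet F := fun w => ⟨z w 0, z w, rfl, hzQ w, hstep w⟩
  refine exists_unpredictable_of_coding h φ (Continuous.subtype_mk (by fun_prop) _)
    (fun w => Subtype.ext ?_) (sub_pos.mpr hF.horizontal_disjoint) fun w w' hne => ?_
  · rw [hh]
    change z (fun n => w (n + 1)) 0 = F (z w 0)
    rw [hstep]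
    simp only [z, hΦshift]
  · refine le_trans ?_ (abs_apply_sub_le_dist (z w 0) (z w' 0) 1)
    rw [hy w 0, hy w' 0]
    have hmem : ∀ w : ℤ → Bool,
        (bif w 0 then 1 - z w (0 + 1) 1 else z w (0 + 1) 1) ∈ Set.Icc (0 : ℝ) 1 := fun w => by
      cases w 0
      · exact (hzQ w _).2
      · exact Set.Icc.mem_iff_one_sub_mem.mp (hzQ w _).2
    refine le_trans (le_of_eq ?_) (sub_le_abs_affine_sub hs (hmem w) (hmem w'))
    cases h0 : w 0 <;> cases h1 : w' 0
    · exact absurd (h0.trans h1.symm) hne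
    · rfl
    · simp only [cond_true, cond_false, abs_sub_comm]
    · exact absurd (h0.trans h1.symm) hne

/-! ### The Hénon map -/

/-- `R` is the positive root of `R ^ 2 = α + c * R`, so radicands up to `α + c * R` have roots in
`[-R, R]`. The last bound then reads `(R - c) ^ 2 ≥ 5 * c ^ 2 / 4`, which is where the threshold on
`α` comes from. -/
lemma henon_radius_bounds {α c : ℝ} (hc : 0 < c) (hα : (5 + 2 * √5) * c ^ 2 / 4 ≤ α) :
    ∃ R, 0 ≤ R ∧ α + c * R = R ^ 2 ∧ (c / 2) ^ 2 ≤ α - c * R := by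
  have h5 : √5 ^ 2 = 5 := Real.sq_sqrt (by norm_num)
  have hα0 : 0 ≤ α := le_trans (by positivity) hα
  have hq : √(c ^ 2 + 4 * α) ^ 2 = c ^ 2 + 4 * α := Real.sq_sqrt (by positivity)
  have hge : c * (1 + √5) ≤ √(c ^ 2 + 4 * α) := by
    apply Real.le_sqrt_of_sq_le
    nlinarith
  have h5' := Real.sqrt_nonneg 5
  set q := √(c ^ 2 + 4 * α)
  refine ⟨(c + q) / 2, by positivity, by nlinarith, ?_⟩
  -- The product equals `(q - c) ^ 2 - 5 * c ^ 2`, and `q - c = 2 * (R - c)`.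
  have h1 : 0 ≤ (q - c * (1 + √5)) * (q - c + c * √5) :=
    mul_nonneg (by linarith) (by nlinarith)
  nlinarith

/-- The square root of `t` with the sign selected by `i`. -/
noncomputable def signedSqrt (i : Bool) (t : ℝ) : ℝ := bif i then -√t else √t

lemma signedSqrt_sq (i : Bool) {t : ℝ} (ht : 0 ≤ t) : signedSqrt i t ^ 2 = t := by
  cases i <;> simp [signedSqrt, ht]

lemma abs_signedSqrt (i : Bool) (t : ℝ) : |signedSqrt i t| = √t := by
  cases i <;> simp [signedSqrt]

lemma abs_signedSqrt_sub (i : Bool) (t t' : ℝ) :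
    |signedSqrt i t - signedSqrt i t'| = |√t - √t'| := by
  cases i
  · rfl
  · simp only [signedSqrt, cond_true]
    rw [← abs_neg]
    congr 1; ring

lemma continuous_signedSqrt (i : Bool) : Continuous (signedSqrt i) := by
  cases i
  · exact Real.continuous_sqrt
  · exact Real.continuous_sqrt.neg

lemma le_abs_signedSqrt_sub {i j : Bool} (hij : i ≠ j) (t t' : ℝ) :
    √t ≤ |signedSqrt i t - signedSqrt j t'| := by
  have h := Real.sqrt_nonneg t
  have h' := Real.sqrt_nonneg t'
  cases i <;> cases j
  · exact absurd rfl hij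
  · refine le_trans ?_ (le_abs_self _)
    simp only [signedSqrt, cond_true, cond_false]; linarith
  · refine le_trans ?_ (neg_le_abs _)
    simp only [signedSqrt, cond_true, cond_false]; linarith
  · exact absurd rfl hij

/-- The sum of the roots is their difference plus twice the smaller one, hence at least `|√t - √t'|
+ c`. Multiplying by `|√t - √t'|` yields the quadratic gain. -/
lemma abs_sqrt_sub_add_sq_le {c t t' e : ℝ} (hc : 0 < c) (ht : (c / 2) ^ 2 ≤ t)
    (ht' : (c / 2) ^ 2 ≤ t') (he : |t - t'| ≤ c * e) :
    |√t - √t'| + c⁻¹ * |√t - √t'| ^ 2 ≤ e := by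
  have hw : c / 2 ≤ √t := Real.le_sqrt_of_sq_le ht
  have hw' : c / 2 ≤ √t' := Real.le_sqrt_of_sq_le ht'
  have h1 : t - t' = (√t - √t') * (√t + √t') := by
    have := Real.sq_sqrt ((sq_nonneg _).trans ht)
    have := Real.sq_sqrt ((sq_nonneg _).trans ht')
    nlinarith
  have hsum : |√t - √t'| + c ≤ √t + √t' := by
    rcases abs_cases (√t - √t') with h | h <;> linarith
  rw [h1, abs_mul, abs_of_nonneg (by linarith : 0 ≤ √t + √t')] at he
  have h2 := (mul_le_mul_of_nonneg_left hsum (abs_nonneg (√t - √t'))).trans he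
  rw [← mul_le_mul_iff_right₀ hc]
  calc c * (|√t - √t'| + c⁻¹ * |√t - √t'| ^ 2) = |√t - √t'| * (|√t - √t'| + c) := by
        field_simp; ring
    _ ≤ c * e := h2

theorem henonMap_exists_unpredictable {α β : ℝ} (hβ : β ≠ 0)
    (hα : (5 + 2 * √5) * (1 + |β|) ^ 2 / 4 ≤ α) :
    ∃ p, IsUnpredictablePoint (iterationFlow (henonMap α β hβ)) p ∧
      ∃ K : Set Plane, IsCompact K ∧ (iterationFlow (henonMap α β hβ)).orbit p ⊆ K := by
  have hc : 0 < 1 + |β| := by positivity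
  obtain ⟨R, hR0, hR, hRc⟩ := henon_radius_bounds hc hα
  set c := 1 + |β| with hcdef
  have hbound : ∀ u v : Set.Icc (-R) R, |v + β * u| ≤ c * R := fun u v => by
    have hu : |(u : ℝ)| ≤ R := abs_le.mpr u.2
    have hv : |(v : ℝ)| ≤ R := abs_le.mpr v.2
    calc |v + β * u| ≤ |(v : ℝ)| + |β| * |(u : ℝ)| := by
          rw [← abs_mul]; exact abs_add_le _ _
      _ ≤ R + |β| * R := by gcongr
      _ = c * R := by rw [hcdef]; ring
  have hlow : ∀ u v : Set.Icc (-R) R, (c / 2) ^ 2 ≤ α - v - β * u := fun u v => by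
    have := (abs_le.mp (hbound u v)).2
    linarith
  let G : Bool → Bool → Set.Icc (-R) R → Set.Icc (-R) R → Set.Icc (-R) R := fun _ j u v =>
    ⟨signedSqrt j (α - v - β * u), abs_le.mp (by
      rw [abs_signedSqrt, Real.sqrt_le_left hR0, ← hR]
      have := (abs_le.mp (hbound u v)).1
      linarith)⟩
  have : Nonempty (Set.Icc (-R) R) := ⟨⟨0, by simpa using hR0⟩⟩
  obtain ⟨Φ, hΦc, hΦ, hΦshift⟩ := exists_coding_of_recursion G
    (fun i j => Continuous.subtype_mk ((continuous_signedSqrt j).comp (by fun_prop)) _)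
    (inv_pos.mpr hc) fun i j u u' v v' e hu hv => by
      rw [Subtype.dist_eq, Real.dist_eq] at hu hv ⊢
      simp only [G, abs_signedSqrt_sub]
      refine abs_sqrt_sub_add_sq_le hc (hlow u v) (hlow u' v') ?_
      calc |α - v - β * u - (α - v' - β * u')|
          = |-((v : ℝ) - v') + -(β * ((u : ℝ) - u'))| := by congr 1; ring
        _ ≤ |(v : ℝ) - v'| + |β| * |(u : ℝ) - u'| := by
          refine (abs_add_le _ _).trans ?_
          rw [abs_neg, abs_neg, abs_mul]
        _ ≤ e + |β| * e := by gcongr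
        _ = c * e := by rw [hcdef]; ring
  have hval : ∀ w n, (Φ w n : ℝ) = signedSqrt (w n) (α - Φ w (n + 1) - β * Φ w (n - 1)) :=
    fun w n => congrArg Subtype.val (hΦ w n)
  refine exists_unpredictable_of_coding (henonMap α β hβ)
    -- The second Hénon coordinate is the previous value of the first.
    (fun w => !₂[(Φ w 0 : ℝ), Φ w (-1)]) (by fun_prop) (fun w => ?_)
    (half_pos hc) fun w w' hne => ?_
  · have hsq : (Φ w 0 : ℝ) ^ 2 = α - Φ w (0 + 1) - β * Φ w (0 - 1) := by
      rw [hval w 0, signedSqrt_sq _ ((sq_nonneg _).trans (hlow _ _))]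
    simp only [hΦshift]
    change _ = (!₂[α - β * (Φ w (-1) : ℝ) - (Φ w 0 : ℝ) ^ 2, (Φ w 0 : ℝ)] : Plane)
    rw [hsq]
    ext i
    fin_cases i
    · simp
    · simp
  · refine le_trans ?_ (abs_apply_sub_le_dist _ _ 0)
    change c / 2 ≤ |(Φ w 0 : ℝ) - Φ w' 0|
    rw [hval w 0, hval w' 0]
    exact (Real.le_sqrt_of_sq_le (hlow _ _)).trans (le_abs_signedSqrt_sub hne _ _)

theorem mainTheorem9 :
    (∀ (lam mu a₀ a₁ b₀ b₁ : ℝ) (F : Plane → Plane), IsSmaleHorseshoe lam mu a₀ a₁ b₀ b₁ F →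
      ∃ h : horseshoeInvariantSet F ≃ₜ horseshoeInvariantSet F,
        (∀ q, (h q : Plane) = F q) ∧
        ∃ p, IsUnpredictablePoint (iterationFlow h) p ∧
          ∃ K : Set (horseshoeInvariantSet F), IsCompact K ∧ (iterationFlow h).orbit p ⊆ K) ∧
    (∀ (α β : ℝ) (hβ : β ≠ 0), (5 + 2 * √5) * (1 + |β|) ^ 2 / 4 ≤ α →
      ∃ p, IsUnpredictablePoint (iterationFlow (henonMap α β hβ)) p ∧
        ∃ K : Set Plane, IsCompact K ∧ (iterationFlow (henonMap α β hβ)).orbit p ⊆ K) := by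
  refine ⟨fun lam mu a₀ a₁ b₀ b₁ F hF => ?_, fun α β hβ hα => henonMap_exists_unpredictable hβ hα⟩
  obtain ⟨h, hh⟩ := exists_homeomorph_horseshoeInvariantSet hF.continuousOn hF.injOn
  exact ⟨h, hh, hF.exists_unpredictable h hh⟩
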